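/- Let $N\ge 1$ and $\ell,m\in\{0,1,2,\dots\}$ be integers, let $T_*\in(0,\infty]$, $L>0$ and $d>\ell+m$, and let $G=G(x,y,t)$ be a real-valued function on $\mathbb R^N\times\mathbb R^N\times(0,T_*)$ satisfying condition (G): * $G\in C^{\ell+m}(\mathbb R^{2N}\times(0,T_*))$; * there is $C_G>0$ such that $$|\nabla_x^jG(x,y,t)|\le C_G\,t^{-\frac{N+j}{d}}\bigl(1+t^{-\frac1d}|x-y|\bigr)^{-N-L-j}$$ for all $x,y\in\mathbb R^N$, $t\in(0,T_*)$ and $j\in\{0,\dots,\ell+m\}$; * $G(x,z,t)=\int_{\mathbb R^N}G(x,y,t-s)\,G(y,z,s)\,dy$ for all $x,z\in\mathbb R^N$ and $0<s<t<T_*$. Here $|\nabla_x^jG|$ is the Euclidean norm of the $N^j$-tuple of all partial derivatives of $G$ of order $j$ in $x$. Let $0<\theta<2$ with $\theta\le\min\{d,L\}$, let $$P_\theta(x,t)=(2\pi)^{-N}\int_{\mathbb R^N}e^{ix\cdot\xi}e^{-t|\xi|^\theta}\,d\xi,\qquad x\in\mathbb R^N,\ t>0,$$ be the fundamental solution of the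 fractional heat equation $\partial_tu+(-\Delta)^{\theta/2}u=0$ in $\mathbb R^N\times(0,\infty)$, and set $K_\theta(x,t):=P_\theta(x,t^{\theta/d})$ for $x\in\mathbb R^N$, $t>0$. Then: (a) For every $j\in\{0,\dots,\ell+m\}$ there exists $c_j>0$ such that $$|\nabla_x^jG(x,y,t)|\le c_j\,t^{-\frac jd}K_\theta(x-y,t)\qquad\text{for all }x,y\in\mathbb R^N,\ t\in(0,T_*).$$ (b) There exists $C_*>0$ such that, for all $x\in\mathbb R^N$ and $0<s<t$, the function $y\mapsto K_\theta(x-y,t-s)K_\theta(y,s)$ is integrable on $\mathbb R^N$ and $$\int_{\mathbb R^N}K_\theta(x-y,t-s)\,K_\theta(y,s)\,dy\le C_*K_\theta(x,t).$$ -/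

import Mathlib

open MeasureTheory

noncomputable section

/-- The Euclidean length `|∇ʲ f(x)|` of the tensor `(∂_{i₁} ⋯ ∂_{iⱼ} f(x))`, indexed by
`(i₁, …, iⱼ) ∈ {1, …, N}ʲ`, of all partial derivatives of order `j` of `f` at `x`. -/
def gradNorm {N : ℕ} (j : ℕ) (f : EuclideanSpace ℝ (Fin N) → ℝ)
    (x : EuclideanSpace ℝ (Fin N)) : ℝ :=
  Real.sqrt (∑ i : Fin j → Fin N,
    (iteratedFDeriv ℝ j f x (fun k => EuclideanSpace.single (i k) (1 : ℝ))) ^ 2)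

/-- Condition (G) on an integral kernel `G = G(x, y, t)` on `ℝᴺ × ℝᴺ × (0, T)`, `T ∈ (0, ∞]`. -/
structure ConditionG {N : ℕ} (ℓ m : ℕ) (d L : ℝ) (T : EReal)
    (G : EuclideanSpace ℝ (Fin N) → EuclideanSpace ℝ (Fin N) → ℝ → ℝ) : Prop where
  T_pos : 0 < T
  lt_d : ((ℓ + m : ℕ) : ℝ) < d
  L_pos : 0 < L
  contDiffOn : ContDiffOn ℝ ((ℓ + m : ℕ) : WithTop ℕ∞)
    (fun p : EuclideanSpace ℝ (Fin N) × EuclideanSpace ℝ (Fin N) × ℝ => G p.1 p.2.1 p.2.2)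
    {p | 0 < p.2.2 ∧ (p.2.2 : EReal) < T}
  bound : ∃ C : ℝ, 0 < C ∧ ∀ j : ℕ, j ≤ ℓ + m →
    ∀ (x y : EuclideanSpace ℝ (Fin N)) (t : ℝ), 0 < t → (t : EReal) < T →
      gradNorm j (fun z => G z y t) x ≤
        C * t ^ (-((N + j : ℝ) / d)) * (1 + t ^ (-(1 / d)) * ‖x - y‖) ^ (-(N : ℝ) - L - j)
  semigroup : ∀ (x z : EuclideanSpace ℝ (Fin N)) (s t : ℝ), 0 < s → s < t → (t : EReal) < T →
    G x z t = ∫ y, G x y (t - s) * G y z s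

/-- The Fourier integral `(2π)⁻ᴺ ∫ exp(i x·ξ) exp(-t |ξ|^θ) dξ`. -/
def fracHeatKernelC {N : ℕ} (θ : ℝ) (x : EuclideanSpace ℝ (Fin N)) (t : ℝ) : ℂ :=
  (((2 * Real.pi) ^ N)⁻¹ : ℝ) * ∫ ξ : EuclideanSpace ℝ (Fin N),
    Complex.exp (Complex.I * (inner ℝ x ξ : ℝ)) * (Real.exp (-t * ‖ξ‖ ^ θ) : ℝ)

/-- The fundamental solution `P_θ(x, t) = (2π)⁻ᴺ ∫ exp(i x·ξ) exp(-t |ξ|^θ) dξ` of the fractional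
heat equation `∂ₜ u + (-Δ)^{θ/2} u = 0` on `ℝᴺ`. The integral is real
(`ofReal_fracHeatKernel`), so nothing is lost by taking its real part. -/
def fracHeatKernel {N : ℕ} (θ : ℝ) (x : EuclideanSpace ℝ (Fin N)) (t : ℝ) : ℝ :=
  (fracHeatKernelC θ x t).re

theorem ofReal_fracHeatKernel {N : ℕ} (θ : ℝ) (x : EuclideanSpace ℝ (Fin N)) (t : ℝ) :
    (fracHeatKernel θ x t : ℂ) = fracHeatKernelC θ x t := by
  rw [fracHeatKernel, ← Complex.conj_eq_iff_re, fracHeatKernelC, map_mul, Complex.conj_ofReal,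
    ← integral_conj]
  congr 1
  rw [← integral_neg_eq_self]
  congr 1
  ext ξ
  simp [← Complex.exp_conj]

/-- The kernel `K_θ(x, t) = P_θ(x, t^{θ/d})`. -/
def majorantKernel {N : ℕ} (d θ : ℝ) (x : EuclideanSpace ℝ (Fin N)) (t : ℝ) : ℝ :=
  fracHeatKernel θ x (t ^ (θ / d))

end

/-!
Write `exp (-|ξ|^θ)` as the Laplace transform, at `|ξ|²`, of the one-sided `θ/2`-stable law `ν`,
which is the image under `-log` of the law of a LePage product over a Poisson process. Then
`P_θ(·, 1)` is a mixture of Gaussians with mixing law `ν`. Since `1 - exp (-q^α) ~ q^α` as `q → 0`,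
with `α = θ/2`, comparing the Gaussian profile from above and below with combinations of the
functions `1 - exp (-k v)`, whose `ν`-integrals are explicit, gives
`P_θ(x, 1) ≍ (1 + |x|)^(-N-θ)`. By scaling, `K_θ(x, t) ≍ ρ^θ (ρ + |x|)^(-N-θ)` with `ρ = t^(1/d)`.

This makes (a) immediate because `θ ≤ L`. For (b), either `t - s` or `s` is comparable to `t`, and
either `|x - y|` or `|y|` is at least `|x| / 2`; hence one of the two factors of the convolution is
bounded by a multiple of `K_θ(x, t)`, while the other one has bounded integral in `y`.
-/

open Filter Topology Set Real

theorem exists_moments_eq_of_tendsto {ι : Type*} {l : Filter ι} [l.NeBot]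
    (ρ : ι → ProbabilityMeasure unitInterval) (φ : ℝ → ℝ)
    (h : ∀ a : ℝ, 0 < a →
      Tendsto (fun n => ∫ v, (v : ℝ) ^ a ∂(ρ n : Measure unitInterval)) l (𝓝 (φ a))) :
    ∃ μ : ProbabilityMeasure unitInterval,
      ∀ a : ℝ, 0 < a → ∫ v, (v : ℝ) ^ a ∂(μ : Measure unitInterval) = φ a := by
  obtain ⟨μ, -, hμ⟩ := isCompact_iff_ultrafilter_le_nhds.1
    (isCompact_univ (X := ProbabilityMeasure unitInterval)) ((Ultrafilter.of l).map ρ) (by simp)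
  have hρ : Tendsto ρ (Ultrafilter.of l : Filter ι) (𝓝 μ) := hμ
  refine ⟨μ, fun a ha => ?_⟩
  have hcont : Continuous fun v : unitInterval => (v : ℝ) ^ a :=
    continuous_subtype_val.rpow_const fun _ => Or.inr ha.le
  exact tendsto_nhds_unique
    (ProbabilityMeasure.tendsto_iff_forall_integral_tendsto.1 hρ
      (BoundedContinuousFunction.mkOfCompact ⟨_, hcont⟩))
    ((h a ha).mono_left (Ultrafilter.of_le l))

-- The law of the product of `n` independent copies.
theorem exists_moments_eq_pow (ρ : ProbabilityMeasure unitInterval) (n : ℕ) :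
    ∃ μ : ProbabilityMeasure unitInterval, ∀ a : ℝ,
      ∫ v, (v : ℝ) ^ a ∂(μ : Measure unitInterval) =
        (∫ v, (v : ℝ) ^ a ∂(ρ : Measure unitInterval)) ^ n := by
  have hprod : Measurable fun x : Fin n → unitInterval => ∏ i, x i := by fun_prop
  refine ⟨⟨_, Measure.isProbabilityMeasure_map hprod.aemeasurable
    (μ := Measure.pi fun _ : Fin n => (ρ : Measure unitInterval))⟩, fun a => ?_⟩
  have hpow (x : Fin n → unitInterval) :
      ((∏ i, x i : unitInterval) : ℝ) ^ a = ∏ i, (x i : ℝ) ^ a := by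
    rw [finsetProd_rpow _ _ fun i _ => (x i).2.1]
    exact congrArg (· ^ a) (map_prod unitInterval.submonoid.subtype x Finset.univ)
  rw [ProbabilityMeasure.coe_mk, integral_map hprod.aemeasurable
    (measurable_subtype_coe.pow_const a).aestronglyMeasurable]
  simp_rw [hpow]
  rw [integral_fintype_prod_eq_pow (ι := Fin n) fun v : unitInterval => (v : ℝ) ^ a,
    Fintype.card_fin]

theorem exists_moments_eq_average {f : ℝ → unitInterval} (hf : Measurable f) {T : ℝ}
    (hT : 0 < T) :
    ∃ μ : ProbabilityMeasure unitInterval, ∀ a : ℝ,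
      ∫ v, (v : ℝ) ^ a ∂(μ : Measure unitInterval) = T⁻¹ * ∫ w in 0..T, (f w : ℝ) ^ a := by
  have hprob : IsProbabilityMeasure (ProbabilityTheory.cond volume (Ioc 0 T)) :=
    ProbabilityTheory.cond_isProbabilityMeasure_of_finite (by simpa using hT) (by simp)
  refine ⟨⟨_, Measure.isProbabilityMeasure_map hf.aemeasurable
    (μ := ProbabilityTheory.cond volume (Ioc 0 T))⟩, fun a => ?_⟩
  rw [ProbabilityMeasure.coe_mk, integral_map hf.aemeasurable
    (measurable_subtype_coe.pow_const a).aestronglyMeasurable, ProbabilityTheory.cond,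
    integral_smul_measure, intervalIntegral.integral_of_le hT.le]
  simp [hT.le]

/- If `w₁, …, wₙ` are independent and uniform on `(0, n)`, the moments of `∏ f(wᵢ)` converge to
those of the product of `f` over a Poisson point process on `(0, ∞)`. -/
theorem exists_moments_eq_exp_neg_integral {f : ℝ → unitInterval} (hf : Measurable f)
    (hint : ∀ a : ℝ, 0 < a → IntegrableOn (fun w => 1 - (f w : ℝ) ^ a) (Ioi 0)) :
    ∃ μ : ProbabilityMeasure unitInterval, ∀ a : ℝ, 0 < a →
      ∫ v, (v : ℝ) ^ a ∂(μ : Measure unitInterval) =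
        exp (-∫ w in Ioi 0, (1 - (f w : ℝ) ^ a)) := by
  choose ρ hρ using fun n : ℕ => exists_moments_eq_average hf (T := n + 1) (by positivity)
  choose μ hμ using fun n : ℕ => exists_moments_eq_pow (ρ n) (n + 1)
  refine exists_moments_eq_of_tendsto (l := atTop) μ _ fun a ha => ?_
  set I : ℝ → ℝ := fun T => ∫ w in 0..T, (1 - (f w : ℝ) ^ a)
  have hI : Tendsto (fun n : ℕ => I n) atTop (𝓝 (∫ w in Ioi 0, (1 - (f w : ℝ) ^ a))) :=
    intervalIntegral_tendsto_integral_Ioi 0 (hint a ha) tendsto_natCast_atTop_atTop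
  have hmoment (n : ℕ) : ∫ v, (v : ℝ) ^ a ∂(μ n : Measure unitInterval) =
      (1 + -(I (n + 1 : ℕ) / (n + 1 : ℕ))) ^ (n + 1) := by
    have hsub : IntervalIntegrable (fun w => 1 - (f w : ℝ) ^ a) volume 0 (n + 1 : ℕ) :=
      (intervalIntegrable_iff_integrableOn_Ioc_of_le (by positivity)).2
        ((hint a ha).mono_set Ioc_subset_Ioi_self)
    have hcompl : ∫ w in 0..((n + 1 : ℕ) : ℝ), (f w : ℝ) ^ a = (n + 1 : ℕ) - I (n + 1 : ℕ) := by
      simpa using intervalIntegral.integral_sub (intervalIntegrable_const (c := (1 : ℝ))) hsub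
    rw [hμ, hρ]
    push_cast at hcompl ⊢
    rw [hcompl]
    field_simp
    ring
  simp_rw [hmoment]
  refine (tendsto_one_add_pow_exp_of_tendsto (g := fun n : ℕ => -(I n / n)) ?_).comp
    (tendsto_add_atTop_nat 1)
  refine hI.neg.congr' ?_
  filter_upwards [eventually_gt_atTop 0] with n hn
  field_simp

theorem one_sub_exp_neg_le (x : ℝ) : 1 - exp (-x) ≤ x := by
  linarith [add_one_le_exp (-x)]

theorem integrableOn_one_sub_exp_neg_rpow {β : ℝ} (hβ : 1 < β) {a : ℝ} (ha : 0 ≤ a) :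
    IntegrableOn (fun w : ℝ => 1 - exp (-(a * w ^ (-β)))) (Ioi 0) := by
  have hnonneg {w : ℝ} (hw : 0 < w) : 0 ≤ 1 - exp (-(a * w ^ (-β))) :=
    sub_nonneg.2 (exp_le_one_iff.2 (neg_nonpos.2 (by positivity)))
  rw [← Ioc_union_Ioi_eq_Ioi (zero_le_one' ℝ)]
  refine IntegrableOn.union ?_ ?_
  · refine Measure.integrableOn_of_bounded (M := 1) (by simp) (by fun_prop) ?_
    refine (ae_restrict_iff' measurableSet_Ioc).2 (ae_of_all _ fun w hw => ?_)
    rw [norm_of_nonneg (hnonneg hw.1)]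
    exact sub_le_self 1 (exp_pos _).le
  · refine ((integrableOn_Ioi_rpow_of_lt (neg_lt_neg hβ) one_pos).const_mul a).mono'
      (by fun_prop) ?_
    refine (ae_restrict_iff' measurableSet_Ioi).2 (ae_of_all _ fun w hw => ?_)
    rw [norm_of_nonneg (hnonneg (one_pos.trans hw))]
    exact one_sub_exp_neg_le _

theorem integral_one_sub_exp_neg_rpow_pos {β : ℝ} (hβ : 1 < β) :
    0 < ∫ w in Ioi (0 : ℝ), (1 - exp (-w ^ (-β))) := by
  have hpos : ∀ w ∈ Ioi (0 : ℝ), 0 < 1 - exp (-w ^ (-β)) := fun w hw =>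
    sub_pos.2 (exp_lt_one_iff.2 (neg_neg_of_pos (rpow_pos_of_pos hw _)))
  rw [setIntegral_pos_iff_support_of_nonneg_ae
    ((ae_restrict_iff' measurableSet_Ioi).2 (ae_of_all _ fun w hw => (hpos w hw).le))
    (by simpa using integrableOn_one_sub_exp_neg_rpow hβ zero_le_one),
    inter_eq_self_of_subset_right (s := Function.support _) fun w hw => (hpos w hw).ne']
  simp

theorem integral_one_sub_exp_neg_mul_rpow {β : ℝ} (hβ : β ≠ 0) {a : ℝ} (ha : 0 < a) :
    ∫ w in Ioi (0 : ℝ), (1 - exp (-(a * w ^ (-β)))) =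
      a ^ β⁻¹ * ∫ w in Ioi (0 : ℝ), (1 - exp (-w ^ (-β))) := by
  have hb : 0 < a ^ β⁻¹ := by positivity
  have hcancel : a * (a ^ β⁻¹) ^ (-β) = 1 := by
    rw [← rpow_mul ha.le, mul_neg, inv_mul_cancel₀ hβ, rpow_neg_one, mul_inv_cancel₀ ha.ne']
  have hsubst := integral_comp_mul_left_Ioi (fun w => 1 - exp (-(a * w ^ (-β)))) 0 hb
  rw [mul_zero, smul_eq_mul] at hsubst
  rw [eq_comm, ← eq_inv_mul_iff_mul_eq₀ hb.ne', ← hsubst]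
  refine setIntegral_congr_fun measurableSet_Ioi fun w hw => ?_
  simp only [mul_rpow hb.le (le_of_lt hw), ← mul_assoc, hcancel, one_mul]

-- The product of `exp (-κ w ^ (-1 / α))` over a unit Poisson process on `(0, ∞)` (LePage).
theorem exists_moments_eq_exp_neg_rpow {α : ℝ} (hα0 : 0 < α) (hα1 : α < 1) :
    ∃ μ : ProbabilityMeasure unitInterval, ∀ a : ℝ, 0 < a →
      ∫ v, (v : ℝ) ^ a ∂(μ : Measure unitInterval) = exp (-a ^ α) := by
  have hβ : 1 < α⁻¹ := (one_lt_inv₀ hα0).2 hα1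
  set c : ℝ := ∫ w in Ioi (0 : ℝ), (1 - exp (-w ^ (-α⁻¹)))
  have hc : 0 < c := integral_one_sub_exp_neg_rpow_pos hβ
  set κ : ℝ := c ^ (-α⁻¹)
  have hκ : 0 < κ := by positivity
  let f : ℝ → unitInterval := fun w => ⟨exp (-(κ * |w| ^ (-α⁻¹))), (exp_pos _).le,
    exp_le_one_iff.2 (neg_nonpos.2 (by positivity))⟩
  have hf : Measurable f := by
    refine Measurable.subtype_mk ?_
    fun_prop
  have hfpow (a : ℝ) : EqOn (fun w => 1 - (f w : ℝ) ^ a)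
      (fun w => 1 - exp (-(a * κ * w ^ (-α⁻¹)))) (Ioi 0) := fun w hw => by
    simp only [f, abs_of_pos (mem_Ioi.1 hw), ← exp_mul]
    ring_nf
  obtain ⟨μ, hμ⟩ := exists_moments_eq_exp_neg_integral hf fun a ha =>
    (integrableOn_one_sub_exp_neg_rpow hβ (by positivity)).congr_fun (hfpow a).symm
      measurableSet_Ioi
  refine ⟨μ, fun a ha => ?_⟩
  have hκc : κ ^ α * c = 1 := by
    rw [← rpow_mul hc.le, neg_mul, inv_mul_cancel₀ hα0.ne', rpow_neg_one, inv_mul_cancel₀ hc.ne']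
  rw [hμ a ha, setIntegral_congr_fun measurableSet_Ioi (hfpow a),
    integral_one_sub_exp_neg_mul_rpow (by positivity) (by positivity), inv_inv,
    mul_rpow ha.le hκ.le, mul_assoc, hκc, mul_one]

theorem rpow_unitInterval_le_one (v : unitInterval) {a : ℝ} (ha : 0 ≤ a) : (v : ℝ) ^ a ≤ 1 :=
  rpow_le_one v.2.1 v.2.2 ha

theorem integrable_rpow_unitInterval (μ : Measure unitInterval) [IsFiniteMeasure μ] {a : ℝ}
    (ha : 0 ≤ a) : Integrable (fun v : unitInterval => (v : ℝ) ^ a) μ := by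
  refine Integrable.of_bound (measurable_subtype_coe.pow_const a).aestronglyMeasurable 1
    (ae_of_all _ fun v => ?_)
  rw [norm_of_nonneg (rpow_nonneg v.2.1 _)]
  exact rpow_unitInterval_le_one v ha

theorem ae_ne_one_of_tendsto_moments {μ : Measure unitInterval} [IsFiniteMeasure μ]
    (h : Tendsto (fun a : ℝ => ∫ v, (v : ℝ) ^ a ∂μ) atTop (𝓝 0)) : ∀ᵐ v ∂μ, v ≠ 1 := by
  have hle : μ.real {1} ≤ 0 := ge_of_tendsto h <| by
    filter_upwards [eventually_ge_atTop 0] with a ha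
    rw [← integral_indicator_one (measurableSet_singleton 1)]
    refine integral_mono ((integrable_const 1).indicator (measurableSet_singleton 1))
      (integrable_rpow_unitInterval μ ha) fun v => ?_
    refine indicator_apply_le' (fun hv => ?_) fun _ => rpow_nonneg v.2.1 a
    simp [mem_singleton_iff.1 hv]
  rw [ae_iff]
  simpa using (measureReal_eq_zero_iff (by simp)).1 (hle.antisymm measureReal_nonneg)

theorem ae_ne_zero_of_tendsto_moments {μ : Measure unitInterval} [IsProbabilityMeasure μ]
    (h : Tendsto (fun a : ℝ => ∫ v, (v : ℝ) ^ a ∂μ) (𝓝[>] 0) (𝓝 1)) : ∀ᵐ v ∂μ, v ≠ 0 := by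
  have hle : 1 ≤ μ.real {0}ᶜ := le_of_tendsto h <| by
    filter_upwards [self_mem_nhdsWithin] with a ha
    rw [← integral_indicator_one (measurableSet_singleton 0).compl]
    refine integral_mono (integrable_rpow_unitInterval μ (le_of_lt ha))
      ((integrable_const 1).indicator (measurableSet_singleton 0).compl) fun v => ?_
    by_cases hv : v = 0
    · simp [hv, zero_rpow (ne_of_gt ha)]
    · simpa [hv] using rpow_unitInterval_le_one v (le_of_lt ha)
  rw [probReal_compl_eq_one_sub (measurableSet_singleton 0)] at hle
  rw [ae_iff]
  simpa using (measureReal_eq_zero_iff (by simp)).1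
    ((show μ.real {0} ≤ 0 by linarith).antisymm measureReal_nonneg)

/-- The law of the one-sided `α`-stable variable with Laplace transform `a ↦ exp (-a ^ α)`, the
value at time one of the `α`-stable subordinator. -/
structure IsOneSidedStable (α : ℝ) (ν : Measure ℝ) : Prop where
  isProbabilityMeasure : IsProbabilityMeasure ν
  ae_pos : ∀ᵐ u ∂ν, 0 < u
  laplace : ∀ a : ℝ, 0 ≤ a → ∫ u, exp (-(a * u)) ∂ν = exp (-a ^ α)

theorem exists_isOneSidedStable {α : ℝ} (hα0 : 0 < α) (hα1 : α < 1) :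
    ∃ ν : Measure ℝ, IsOneSidedStable α ν := by
  obtain ⟨μ, hμ⟩ := exists_moments_eq_exp_neg_rpow hα0 hα1
  have hone : ∀ᵐ v ∂(μ : Measure unitInterval), v ≠ 1 := by
    refine ae_ne_one_of_tendsto_moments (Tendsto.congr' ?_
      (tendsto_exp_neg_atTop_nhds_zero.comp (tendsto_rpow_atTop hα0)))
    filter_upwards [eventually_gt_atTop 0] with a ha using (hμ a ha).symm
  have hzero : ∀ᵐ v ∂(μ : Measure unitInterval), v ≠ 0 := by
    have hcont : Continuous fun a : ℝ => exp (-a ^ α) :=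
      continuous_exp.comp (continuous_id.rpow_const fun _ => Or.inr hα0.le).neg
    have hlim : Tendsto (fun a : ℝ => exp (-a ^ α)) (𝓝[>] 0) (𝓝 1) :=
      (hcont.tendsto' 0 1 (by simp [zero_rpow hα0.ne'])).mono_left nhdsWithin_le_nhds
    refine ae_ne_zero_of_tendsto_moments (hlim.congr' ?_)
    filter_upwards [self_mem_nhdsWithin] with a ha using (hμ a ha).symm
  have hlog : Measurable fun v : unitInterval => -log v := by fun_prop
  refine ⟨_, Measure.isProbabilityMeasure_map hlog.aemeasurable
    (μ := (μ : Measure unitInterval)), ?_, fun a ha => ?_⟩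
  · rw [ae_map_iff hlog.aemeasurable measurableSet_Ioi]
    filter_upwards [hone, hzero] with v hv1 hv0
    exact neg_pos.2 (log_neg (unitInterval.pos_iff_ne_zero.2 hv0)
      (unitInterval.lt_one_iff_ne_one.2 hv1))
  · rcases ha.eq_or_lt with rfl | ha
    · have := Measure.isProbabilityMeasure_map hlog.aemeasurable (μ := (μ : Measure unitInterval))
      simp [zero_rpow hα0.ne']
    rw [integral_map hlog.aemeasurable (by fun_prop), ← hμ a ha]
    refine integral_congr_ae ?_
    filter_upwards [hzero] with v hv0
    rw [rpow_def_of_pos (unitInterval.pos_iff_ne_zero.2 hv0), mul_neg, neg_neg, mul_comm]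

theorem rpow_mul_exp_neg_le {s w : ℝ} (hs : 0 ≤ s) (hw : 0 ≤ w) : w ^ s * exp (-w) ≤ s ^ s := by
  rcases hs.eq_or_lt with rfl | hs
  · simpa using hw
  have hexp : (w / s) ^ s ≤ exp w := calc
    (w / s) ^ s ≤ exp (w / s) ^ s := by
      gcongr
      linarith [add_one_le_exp (w / s)]
    _ = exp w := by rw [← exp_mul, div_mul_cancel₀ w hs.ne']
  rw [div_rpow hw hs.le, div_le_iff₀ (by positivity)] at hexp
  rw [exp_neg, ← div_eq_mul_inv, div_le_iff₀ (exp_pos w)]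
  linarith

/-- The time profile `u ^ (-s) exp (-r² / 4u)` of the heat kernel at distance `r` from the source;
in dimension `N` one has `s = N / 2`, and the factor `(4π) ^ (-s)` is left out. -/
noncomputable def heatProfile (s r u : ℝ) : ℝ := u ^ (-s) * exp (-(r ^ 2 / (4 * u)))

theorem heatProfile_zero (s u : ℝ) : heatProfile s 0 u = u ^ (-s) := by simp [heatProfile]

theorem heatProfile_pos (s r : ℝ) {u : ℝ} (hu : 0 < u) : 0 < heatProfile s r u := by
  unfold heatProfile
  positivity

@[fun_prop]
theorem measurable_heatProfile (s r : ℝ) : Measurable (heatProfile s r) := by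
  unfold heatProfile
  fun_prop

theorem heatProfile_anti (s : ℝ) {r₁ r₂ u : ℝ} (hr₁ : 0 ≤ r₁) (hr : r₁ ≤ r₂) (hu : 0 < u) :
    heatProfile s r₂ u ≤ heatProfile s r₁ u := by
  unfold heatProfile
  gcongr

theorem heatProfile_scaling (s : ℝ) {r u : ℝ} (hr : 0 < r) (hu : 0 ≤ u) :
    heatProfile s r u = r ^ (-(2 * s)) * heatProfile s 1 ((r ^ 2)⁻¹ * u) := by
  have hpow : r ^ (-(2 * s)) = (r ^ 2) ^ (-s) := by
    rw [← rpow_two, ← rpow_mul hr.le, mul_neg]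
  have hmul : u ^ (-s) = (r ^ 2) ^ (-s) * ((r ^ 2)⁻¹ * u) ^ (-s) := by
    rw [← mul_rpow (by positivity) (by positivity), mul_inv_cancel_left₀ (by positivity)]
  have hdiv : r ^ 2 / (4 * u) = 1 ^ 2 / (4 * ((r ^ 2)⁻¹ * u)) := by field_simp
  rw [heatProfile, heatProfile, hpow, hdiv, hmul, mul_assoc]

theorem heatProfile_one_le {s v : ℝ} (hs : 0 ≤ s) (hv : 0 < v) :
    heatProfile s 1 v ≤ (4 * s) ^ s := by
  have hpow : v ^ (-s) = 4 ^ s * (1 / (4 * v)) ^ s := by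
    rw [← mul_rpow (by norm_num) (by positivity), rpow_neg hv.le, ← inv_rpow hv.le]
    field_simp
  rw [heatProfile, hpow, one_pow, mul_assoc, mul_rpow (by norm_num) hs]
  gcongr
  exact rpow_mul_exp_neg_le hs (by positivity)

theorem heatProfile_one_le_mul {s v : ℝ} (hs : 0 ≤ s) (hv : 0 < v) :
    heatProfile s 1 v ≤ (4 * (s + 1)) ^ (s + 1) * v := by
  have hshift : heatProfile s 1 v = heatProfile (s + 1) 1 v * v := by
    rw [heatProfile, heatProfile, mul_right_comm, ← rpow_add_one hv.ne', neg_add,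
      neg_add_cancel_right]
  rw [hshift]
  gcongr
  exact heatProfile_one_le (by linarith) hv

theorem div_one_add_le_one_sub_exp_neg {v : ℝ} (hv : 0 ≤ v) : v / (1 + v) ≤ 1 - exp (-v) := by
  have hinv : exp (-v) ≤ (1 + v)⁻¹ := by
    rw [exp_neg]
    gcongr
    linarith [add_one_le_exp v]
  have hdiv : v / (1 + v) = 1 - (1 + v)⁻¹ := by
    field_simp
    ring
  linarith

theorem exists_heatProfile_one_le_one_sub_exp_neg {s : ℝ} (hs : 0 ≤ s) :
    ∃ A : ℝ, 0 < A ∧ ∀ v : ℝ, 0 < v → heatProfile s 1 v ≤ A * (1 - exp (-v)) := by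
  refine ⟨(4 * s) ^ s + (4 * (s + 1)) ^ (s + 1), by positivity, fun v hv => ?_⟩
  calc heatProfile s 1 v ≤ ((4 * s) ^ s + (4 * (s + 1)) ^ (s + 1)) * (v / (1 + v)) := by
        rw [← mul_div_assoc, le_div_iff₀ (by positivity)]
        linarith [mul_le_mul_of_nonneg_right (heatProfile_one_le hs hv) hv.le,
          heatProfile_one_le_mul hs hv]
    _ ≤ _ := by
        gcongr
        exact div_one_add_le_one_sub_exp_neg hv.le

theorem sub_sq_div_two_le_one_sub_exp_neg {x : ℝ} (hx : 0 ≤ x) :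
    x - x ^ 2 / 2 ≤ 1 - exp (-x) := by
  have hinv : exp (-x) ≤ 1 - x + x ^ 2 / 2 := by
    rw [exp_neg, inv_le_iff_one_le_mul₀ (exp_pos x)]
    have hnonneg : 0 ≤ 1 - x + x ^ 2 / 2 := by nlinarith [sq_nonneg (x - 1)]
    nlinarith [mul_le_mul_of_nonneg_left (quadratic_le_exp_of_nonneg hx) hnonneg,
      sq_nonneg (x ^ 2)]
  linarith

/-- A combination of functions `1 - exp (-a v)` that is nonpositive for `v ≤ η / M` and for
`2 M / η ≤ v`. Under a one-sided stable law its expectation at `q v` is nevertheless of the order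
of `q ^ α` for suitable `η` and `M`, so the law charges the band in between. -/
noncomputable def bandTest (η M v : ℝ) : ℝ :=
  (1 - exp (-v)) - (1 - exp (-(η * v))) - M⁻¹ * (1 - exp (-(M * v)))

theorem bandTest_nonpos_of_le {η M v : ℝ} (hη : 0 < η) (hη1 : η ≤ 1) (hM : 1 ≤ M) (hv : 0 ≤ v)
    (h : v ≤ η / M) : bandTest η M v ≤ 0 := by
  have hM0 : 0 < M := one_pos.trans_le hM
  have hvM : v * M ≤ η := (le_div_iff₀ hM0).1 h
  have hMterm : v - M * v ^ 2 / 2 ≤ M⁻¹ * (1 - exp (-(M * v))) := calc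
    v - M * v ^ 2 / 2 = M⁻¹ * (M * v - (M * v) ^ 2 / 2) := by field_simp
    _ ≤ _ := mul_le_mul_of_nonneg_left
      (sub_sq_div_two_le_one_sub_exp_neg (by positivity)) (by positivity)
  have hMsq : M * v ^ 2 ≤ η * v := by nlinarith
  have hηsq : (η * v) ^ 2 ≤ η * v := by
    have hle : η * v ≤ 1 := by nlinarith
    nlinarith [mul_nonneg hη.le hv]
  unfold bandTest
  linarith [one_sub_exp_neg_le v, sub_sq_div_two_le_one_sub_exp_neg (mul_nonneg hη.le hv)]

theorem bandTest_nonpos_of_ge {η M v : ℝ} (hη : 0 < η) (hM : 1 ≤ M) (h : 2 * M / η ≤ v) :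
    bandTest η M v ≤ 0 := by
  have hM0 : 0 < M := one_pos.trans_le hM
  have hv : 0 ≤ v := le_trans (by positivity) h
  have hηexp : exp (-(η * v)) ≤ M⁻¹ / 2 := by
    rw [exp_neg, div_eq_mul_inv, ← mul_inv]
    gcongr
    linarith [add_one_le_exp (η * v), (div_le_iff₀ hη).1 h]
  have hMexp : M⁻¹ * exp (-(M * v)) ≤ 1 * exp (-v) := by
    gcongr
    · exact inv_le_one_of_one_le₀ hM
    · exact le_mul_of_one_le_left hv hM
  unfold bandTest
  linarith [inv_pos.2 hM0]

theorem bandTest_le_one {η M v : ℝ} (hη : 0 ≤ η) (hM : 0 ≤ M) (hv : 0 ≤ v) :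
    bandTest η M v ≤ 1 := by
  have hηexp : exp (-(η * v)) ≤ 1 := exp_le_one_iff.2 (neg_nonpos.2 (by positivity))
  have hMexp : exp (-(M * v)) ≤ 1 := exp_le_one_iff.2 (neg_nonpos.2 (by positivity))
  have hMterm : 0 ≤ M⁻¹ * (1 - exp (-(M * v))) :=
    mul_nonneg (inv_nonneg.2 hM) (sub_nonneg.2 hMexp)
  unfold bandTest
  linarith [exp_pos (-v)]

theorem exists_bandTest_le_heatProfile_one {s η M : ℝ} (hs : 0 ≤ s) (hη : 0 < η) (hη1 : η ≤ 1)
    (hM : 1 ≤ M) :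
    ∃ B : ℝ, 0 < B ∧ ∀ v : ℝ, 0 < v → bandTest η M v ≤ B * heatProfile s 1 v := by
  have hM0 : 0 < M := one_pos.trans_le hM
  set D : ℝ := (2 * M / η) ^ (-s) * exp (-(1 ^ 2 / (4 * (η / M))))
  have hD : 0 < D := by positivity
  refine ⟨D⁻¹, inv_pos.2 hD, fun v hv => ?_⟩
  have hrhs : 0 ≤ D⁻¹ * heatProfile s 1 v :=
    mul_nonneg (inv_nonneg.2 hD.le) (heatProfile_pos s 1 hv).le
  rcases le_total v (η / M) with hsmall | hsmall
  · exact (bandTest_nonpos_of_le hη hη1 hM hv.le hsmall).trans hrhs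
  rcases le_total (2 * M / η) v with hlarge | hlarge
  · exact (bandTest_nonpos_of_ge hη hM hlarge).trans hrhs
  have hband : D ≤ heatProfile s 1 v := by
    refine mul_le_mul (rpow_le_rpow_of_nonpos hv hlarge (neg_nonpos.2 hs)) ?_ (exp_pos _).le
      (by positivity)
    gcongr
  calc bandTest η M v ≤ 1 := bandTest_le_one hη.le hM0.le hv.le
    _ ≤ D⁻¹ * heatProfile s 1 v := by rwa [← div_eq_inv_mul, one_le_div hD]

theorem exists_mul_one_add_rpow_neg_le_of_antitoneOn {Q : ℝ → ℝ} {p a R : ℝ}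
    (hQ : AntitoneOn Q (Ici 0)) (ha : 0 < a) (hR : 0 ≤ R)
    (h : ∀ r, R ≤ r → 0 < r → a * r ^ (-p) ≤ Q r) :
    ∃ c : ℝ, 0 < c ∧ ∀ r, 0 ≤ r → c * (1 + r) ^ (-p) ≤ Q r := by
  refine ⟨a * (1 + R) ^ (-p), by positivity, fun r hr => ?_⟩
  calc a * (1 + R) ^ (-p) * (1 + r) ^ (-p) = a * ((1 + R) * (1 + r)) ^ (-p) := by
        rw [mul_assoc, ← mul_rpow (by positivity) (by positivity)]
    _ ≤ Q ((1 + R) * (1 + r)) := h _ (by nlinarith) (by positivity)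
    _ ≤ Q r := hQ hr (mem_Ici.2 (by positivity)) (by nlinarith)

theorem exists_le_mul_one_add_rpow_neg_of_antitoneOn {Q : ℝ → ℝ} {p A : ℝ} (hp : 0 ≤ p)
    (hQ : AntitoneOn Q (Ici 0)) (hA : 0 < A) (h : ∀ r, 0 < r → Q r ≤ A * r ^ (-p)) :
    ∃ C : ℝ, 0 < C ∧ ∀ r, 0 ≤ r → Q r ≤ C * (1 + r) ^ (-p) := by
  have hcompare {r x : ℝ} (hr : 0 ≤ r) (hx : 0 < x) (hrx : 1 + r ≤ 2 * x) :
      x ^ (-p) ≤ 2 ^ p * (1 + r) ^ (-p) := calc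
    x ^ (-p) = 2 ^ p * (2 * x) ^ (-p) := by
      rw [mul_rpow zero_le_two hx.le, ← mul_assoc, ← rpow_add two_pos, add_neg_cancel, rpow_zero,
        one_mul]
    _ ≤ _ := by
      gcongr ?_ * ?_
      exact rpow_le_rpow_of_nonpos (by positivity) hrx (neg_nonpos.2 hp)
  refine ⟨max A (Q 0) * 2 ^ p, mul_pos (lt_max_of_lt_left hA) (by positivity), fun r hr => ?_⟩
  rw [mul_assoc]
  rcases le_total r 1 with hr1 | hr1
  · calc Q r ≤ max A (Q 0) * 1 ^ (-p) := by
          rw [one_rpow, mul_one]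
          exact (hQ self_mem_Ici hr hr).trans (le_max_right _ _)
      _ ≤ _ := by gcongr; exact hcompare hr one_pos (by linarith)
  · have hr0 : 0 < r := one_pos.trans_le hr1
    calc Q r ≤ max A (Q 0) * r ^ (-p) := (h r hr0).trans (by gcongr; exact le_max_left _ _)
      _ ≤ _ := by gcongr; exact hcompare hr hr0 (by linarith)

namespace IsOneSidedStable

variable {α : ℝ} {ν : Measure ℝ}

theorem integrable_exp_neg_mul (hν : IsOneSidedStable α ν) {a : ℝ} (ha : 0 ≤ a) :
    Integrable (fun u => exp (-(a * u))) ν := by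
  have := hν.isProbabilityMeasure
  refine Integrable.of_bound (by fun_prop) 1 ?_
  filter_upwards [hν.ae_pos] with u hu
  rw [norm_of_nonneg (exp_pos _).le]
  exact exp_le_one_iff.2 (neg_nonpos.2 (by positivity))

theorem integrable_one_sub_exp_neg_mul (hν : IsOneSidedStable α ν) {a : ℝ} (ha : 0 ≤ a) :
    Integrable (fun u => 1 - exp (-(a * u))) ν :=
  have := hν.isProbabilityMeasure
  (integrable_const 1).sub (hν.integrable_exp_neg_mul ha)

theorem integral_one_sub_exp_neg_mul (hν : IsOneSidedStable α ν) {a : ℝ} (ha : 0 ≤ a) :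
    ∫ u, (1 - exp (-(a * u))) ∂ν = 1 - exp (-a ^ α) := by
  have := hν.isProbabilityMeasure
  rw [integral_sub (integrable_const 1) (hν.integrable_exp_neg_mul ha), hν.laplace a ha]
  simp

theorem integrable_heatProfile {s r : ℝ} (hν : IsOneSidedStable α ν) (hr : 0 ≤ r)
    (hint : Integrable (fun u => u ^ (-s)) ν) : Integrable (heatProfile s r) ν := by
  refine hint.mono' (by fun_prop) ?_
  filter_upwards [hν.ae_pos] with u hu
  rw [norm_of_nonneg (heatProfile_pos s r hu).le, ← heatProfile_zero]
  exact heatProfile_anti s le_rfl hr hu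

theorem integrable_heatProfile_one_mul {s q : ℝ} (hν : IsOneSidedStable α ν) (hs : 0 ≤ s)
    (hq : 0 < q) : Integrable (fun u => heatProfile s 1 (q * u)) ν := by
  have := hν.isProbabilityMeasure
  refine Integrable.of_bound
    ((measurable_heatProfile s 1).comp (measurable_const_mul q)).aestronglyMeasurable
    ((4 * s) ^ s) ?_
  filter_upwards [hν.ae_pos] with u hu
  rw [norm_of_nonneg (heatProfile_pos s 1 (by positivity)).le]
  exact heatProfile_one_le hs (by positivity)

theorem antitoneOn_integral_heatProfile {s : ℝ} (hν : IsOneSidedStable α ν)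
    (hint : Integrable (fun u => u ^ (-s)) ν) :
    AntitoneOn (fun r => ∫ u, heatProfile s r u ∂ν) (Ici 0) := fun r₁ hr₁ r₂ hr₂ hr => by
  refine integral_mono_ae (hν.integrable_heatProfile hr₂ hint)
    (hν.integrable_heatProfile hr₁ hint) ?_
  filter_upwards [hν.ae_pos] with u hu using heatProfile_anti s hr₁ hr hu

theorem integral_heatProfile_scaling {s r : ℝ} (hν : IsOneSidedStable α ν) (hr : 0 < r) :
    ∫ u, heatProfile s r u ∂ν =
      r ^ (-(2 * s)) * ∫ u, heatProfile s 1 ((r ^ 2)⁻¹ * u) ∂ν := by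
  rw [← integral_const_mul]
  refine integral_congr_ae ?_
  filter_upwards [hν.ae_pos] with u hu using heatProfile_scaling s hr hu.le

theorem exists_integral_heatProfile_one_mul_le {s : ℝ} (hν : IsOneSidedStable α ν) (hs : 0 ≤ s) :
    ∃ A : ℝ, 0 < A ∧ ∀ q : ℝ, 0 < q → ∫ u, heatProfile s 1 (q * u) ∂ν ≤ A * q ^ α := by
  obtain ⟨A, hA, hprofile⟩ := exists_heatProfile_one_le_one_sub_exp_neg hs
  refine ⟨A, hA, fun q hq => ?_⟩
  calc ∫ u, heatProfile s 1 (q * u) ∂ν ≤ ∫ u, A * (1 - exp (-(q * u))) ∂ν := by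
        refine integral_mono_ae (hν.integrable_heatProfile_one_mul hs hq)
          ((hν.integrable_one_sub_exp_neg_mul hq.le).const_mul A) ?_
        filter_upwards [hν.ae_pos] with u hu using hprofile _ (by positivity)
    _ = A * (1 - exp (-q ^ α)) := by
        rw [integral_const_mul, hν.integral_one_sub_exp_neg_mul hq.le]
    _ ≤ A * q ^ α := by
        gcongr
        exact one_sub_exp_neg_le _

theorem integrable_bandTest {η M q : ℝ} (hν : IsOneSidedStable α ν) (hη : 0 ≤ η) (hM : 0 ≤ M)
    (hq : 0 ≤ q) : Integrable (fun u => bandTest η M (q * u)) ν := by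
  simp only [bandTest, ← mul_assoc]
  exact ((hν.integrable_one_sub_exp_neg_mul hq).sub
    (hν.integrable_one_sub_exp_neg_mul (by positivity))).sub
      ((hν.integrable_one_sub_exp_neg_mul (by positivity)).const_mul _)

theorem integral_bandTest {η M q : ℝ} (hν : IsOneSidedStable α ν) (hη : 0 ≤ η) (hM : 0 ≤ M)
    (hq : 0 ≤ q) :
    ∫ u, bandTest η M (q * u) ∂ν =
      (1 - exp (-q ^ α)) - (1 - exp (-(η ^ α * q ^ α))) -
        M⁻¹ * (1 - exp (-(M ^ α * q ^ α))) := by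
  have hint {a : ℝ} (ha : 0 ≤ a) := hν.integrable_one_sub_exp_neg_mul ha
  have hdiff : Integrable (fun u => (1 - exp (-(q * u))) - (1 - exp (-(η * q * u)))) ν :=
    (hint hq).sub (hint (by positivity))
  simp only [bandTest, ← mul_assoc]
  rw [integral_sub hdiff ((hint (by positivity)).const_mul _),
    integral_sub (hint hq) (hint (by positivity)), integral_const_mul]
  simp only [hν.integral_one_sub_exp_neg_mul, hq, mul_nonneg, hη, hM, mul_rpow]

theorem exists_bandTest_integral_ge (hν : IsOneSidedStable α ν) (hα0 : 0 < α) (hα1 : α < 1) :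
    ∃ η M : ℝ, 0 < η ∧ η ≤ 1 ∧ 1 ≤ M ∧
      ∀ q : ℝ, 0 ≤ q → q ^ α ≤ 1 / 2 → q ^ α / 4 ≤ ∫ u, bandTest η M (q * u) ∂ν := by
  set η : ℝ := (1 / 4) ^ α⁻¹
  set M : ℝ := 4 ^ (1 - α)⁻¹
  have hM1 : 1 ≤ M := one_le_rpow (by norm_num) (inv_nonneg.2 (by linarith))
  have hM0 : 0 < M := one_pos.trans_le hM1
  have hηα : η ^ α = 1 / 4 := rpow_inv_rpow (by norm_num) hα0.ne'
  have hMα : M⁻¹ * M ^ α = 1 / 4 := by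
    have hpow : M ^ (1 - α) = 4 := rpow_inv_rpow (by norm_num) (by linarith)
    rw [rpow_sub hM0, rpow_one, div_eq_iff (by positivity)] at hpow
    field_simp
    linarith
  refine ⟨η, M, by positivity, rpow_le_one (by norm_num) (by norm_num) (by positivity), hM1,
    fun q hq hσ => ?_⟩
  rw [hν.integral_bandTest (by positivity) hM0.le hq, hηα]
  have hMterm : M⁻¹ * (1 - exp (-(M ^ α * q ^ α))) ≤ 1 / 4 * q ^ α := by
    rw [← hMα, mul_assoc]
    gcongr
    exact one_sub_exp_neg_le _
  have hσ0 : 0 ≤ q ^ α := by positivity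
  nlinarith [sub_sq_div_two_le_one_sub_exp_neg hσ0, one_sub_exp_neg_le (1 / 4 * q ^ α)]

theorem exists_le_integral_heatProfile_one_mul {s : ℝ} (hν : IsOneSidedStable α ν) (hs : 0 ≤ s)
    (hα0 : 0 < α) (hα1 : α < 1) :
    ∃ a : ℝ, 0 < a ∧ ∀ q : ℝ, 0 < q → q ^ α ≤ 1 / 2 →
      a * q ^ α ≤ ∫ u, heatProfile s 1 (q * u) ∂ν := by
  obtain ⟨η, M, hη, hη1, hM, hge⟩ := hν.exists_bandTest_integral_ge hα0 hα1
  obtain ⟨B, hB, hband⟩ := exists_bandTest_le_heatProfile_one hs hη hη1 hM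
  refine ⟨(4 * B)⁻¹, by positivity, fun q hq hσ => ?_⟩
  have hle : q ^ α / 4 ≤ B * ∫ u, heatProfile s 1 (q * u) ∂ν := by
    rw [← integral_const_mul]
    refine (hge q hq.le hσ).trans (integral_mono_ae
      (hν.integrable_bandTest hη.le (zero_le_one.trans hM) hq.le)
      ((hν.integrable_heatProfile_one_mul hs hq).const_mul B) ?_)
    filter_upwards [hν.ae_pos] with u hu using hband _ (by positivity)
  rw [inv_mul_le_iff₀ (by positivity)]
  linarith

theorem exists_integral_heatProfile_bounds {s : ℝ} (hν : IsOneSidedStable α ν) (hs : 0 ≤ s)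
    (hα0 : 0 < α) (hα1 : α < 1) (hint : Integrable (fun u => u ^ (-s)) ν) :
    ∃ c C : ℝ, 0 < c ∧ 0 < C ∧ ∀ r : ℝ, 0 ≤ r →
      c * (1 + r) ^ (-(2 * s + 2 * α)) ≤ ∫ u, heatProfile s r u ∂ν ∧
      ∫ u, heatProfile s r u ∂ν ≤ C * (1 + r) ^ (-(2 * s + 2 * α)) := by
  have hp : 0 ≤ 2 * s + 2 * α := by positivity
  have hpow {r : ℝ} (hr : 0 < r) : ((r ^ 2)⁻¹) ^ α = r ^ (-(2 * α)) := by
    rw [← rpow_two, ← rpow_neg hr.le, ← rpow_mul hr.le, neg_mul]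
  have hmul {r : ℝ} (hr : 0 < r) (b : ℝ) :
      b * r ^ (-(2 * s + 2 * α)) = r ^ (-(2 * s)) * (b * ((r ^ 2)⁻¹) ^ α) := by
    rw [hpow hr, mul_left_comm, ← rpow_add hr, neg_add]
  obtain ⟨A, hA, hupper⟩ := hν.exists_integral_heatProfile_one_mul_le hs
  obtain ⟨a, ha, hlower⟩ := hν.exists_le_integral_heatProfile_one_mul hs hα0 hα1
  have hanti := hν.antitoneOn_integral_heatProfile hint
  obtain ⟨C, hC, hleC⟩ := exists_le_mul_one_add_rpow_neg_of_antitoneOn hp hanti hA fun r hr => by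
    rw [hν.integral_heatProfile_scaling hr, hmul hr]
    gcongr
    exact hupper _ (by positivity)
  set R : ℝ := (1 / 2) ^ (-(2 * α))⁻¹
  have hR : R ^ (-(2 * α)) = 1 / 2 := rpow_inv_rpow (by norm_num) (by simp [hα0.ne'])
  obtain ⟨c, hc, hcle⟩ := exists_mul_one_add_rpow_neg_le_of_antitoneOn hanti ha
    (R := R) (by positivity) fun r hRr hr => by
      rw [hν.integral_heatProfile_scaling hr, hmul hr]
      gcongr
      refine hlower _ (by positivity) ?_
      rw [hpow hr, ← hR]
      exact rpow_le_rpow_of_nonpos (by positivity) hRr (by linarith)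
  exact ⟨c, C, hc, hC, fun r hr => ⟨hcle r hr, hleC r hr⟩⟩

end IsOneSidedStable

section FiniteDimensional

open Module

theorem integrable_exp_neg_norm_rpow {V : Type*} [NormedAddCommGroup V] [NormedSpace ℝ V]
    [FiniteDimensional ℝ V] [MeasurableSpace V] [BorelSpace V] (μ : Measure V)
    [μ.IsAddHaarMeasure] {θ : ℝ} (hθ : 0 < θ) : Integrable (fun ξ : V => exp (-‖ξ‖ ^ θ)) μ := by
  rcases subsingleton_or_nontrivial V with hV | hV
  · exact continuous_of_discreteTopology.integrable_of_hasCompactSupport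
      (HasCompactSupport.of_compactSpace _)
  rw [integrable_fun_norm_addHaar μ (f := fun r => exp (-r ^ θ))]
  have hint := integrableOn_rpow_mul_exp_neg_rpow (s := ((finrank ℝ V - 1 : ℕ) : ℝ))
    (neg_one_lt_zero.trans_le (Nat.cast_nonneg _)) hθ
  simpa only [rpow_natCast, smul_eq_mul] using hint

theorem IsOneSidedStable.laplace_norm_sq {V : Type*} [SeminormedAddCommGroup V] {θ : ℝ}
    {ν : Measure ℝ} (hν : IsOneSidedStable (θ / 2) ν) (ξ : V) :
    ∫ u, exp (-(‖ξ‖ ^ 2 * u)) ∂ν = exp (-‖ξ‖ ^ θ) := by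
  rw [hν.laplace _ (by positivity), ← rpow_two, ← rpow_mul (norm_nonneg _),
    mul_div_cancel₀ θ two_ne_zero]

variable {V : Type*} [NormedAddCommGroup V] [InnerProductSpace ℝ V] [FiniteDimensional ℝ V]
  [MeasurableSpace V] [BorelSpace V]

theorem integral_exp_neg_norm_sq_mul {u : ℝ} (hu : 0 < u) :
    ∫ ξ : V, exp (-(‖ξ‖ ^ 2 * u)) = π ^ (finrank ℝ V / 2 : ℝ) * u ^ (-(finrank ℝ V / 2 : ℝ)) := by
  rw [rpow_neg hu.le, ← div_eq_mul_inv, ← div_rpow pi_pos.le hu.le,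
    ← GaussianFourier.integral_rexp_neg_mul_sq_norm hu]
  simp only [neg_mul, mul_comm u]

theorem integral_cexp_inner_mul_exp_neg_norm_sq_mul (x : V) {u : ℝ} (hu : 0 < u) :
    ∫ ξ : V, Complex.exp (Complex.I * (inner ℝ x ξ : ℝ)) * (exp (-(‖ξ‖ ^ 2 * u)) : ℝ) =
      (π ^ (finrank ℝ V / 2 : ℝ) * heatProfile (finrank ℝ V / 2) ‖x‖ u : ℝ) := by
  have hgauss := GaussianFourier.integral_cexp_neg_mul_sq_norm_add (b := (u : ℂ))
    (by simpa using hu) Complex.I x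
  have hprefactor : ((π : ℂ) / u) ^ (finrank ℝ V / 2 : ℂ) =
      (π ^ (finrank ℝ V / 2 : ℝ) * u ^ (-(finrank ℝ V / 2 : ℝ)) : ℝ) := by
    rw [rpow_neg hu.le, ← div_eq_mul_inv, ← div_rpow pi_pos.le hu.le,
      Complex.ofReal_cpow (by positivity)]
    push_cast
    rfl
  have hexponent : Complex.I ^ 2 * (‖x‖ : ℂ) ^ 2 / (4 * u) = (-(‖x‖ ^ 2 / (4 * u)) : ℝ) := by
    rw [Complex.I_sq]
    push_cast
    ring
  rw [hprefactor, hexponent, ← Complex.ofReal_exp, ← Complex.ofReal_mul, mul_assoc] at hgauss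
  rw [heatProfile, ← hgauss]
  congr 1 with ξ
  rw [Complex.ofReal_exp, ← Complex.exp_add]
  congr 1
  push_cast
  ring

namespace IsOneSidedStable

variable {θ : ℝ} {ν : Measure ℝ}

theorem integrable_exp_neg_norm_sq_mul (hν : IsOneSidedStable (θ / 2) ν) (hθ : 0 < θ) :
    Integrable (fun p : ℝ × V => exp (-(‖p.2‖ ^ 2 * p.1))) (ν.prod volume) := by
  have := hν.isProbabilityMeasure
  rw [integrable_prod_iff' (by fun_prop)]
  refine ⟨ae_of_all _ fun ξ => hν.integrable_exp_neg_mul (sq_nonneg ‖ξ‖), ?_⟩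
  simp only [norm_of_nonneg (exp_pos _).le, hν.laplace_norm_sq]
  exact integrable_exp_neg_norm_rpow volume hθ

variable (V) in
theorem integrable_rpow_neg_finrank_div_two (hν : IsOneSidedStable (θ / 2) ν) (hθ : 0 < θ) :
    Integrable (fun u => u ^ (-(finrank ℝ V / 2 : ℝ))) ν := by
  have := hν.isProbabilityMeasure
  refine ((hν.integrable_exp_neg_norm_sq_mul (V := V) hθ).integral_prod_left.const_mul
    (π ^ (finrank ℝ V / 2 : ℝ))⁻¹).congr ?_
  filter_upwards [hν.ae_pos] with u hu
  rw [integral_exp_neg_norm_sq_mul hu, inv_mul_cancel_left₀ (by positivity)]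

theorem integral_cexp_inner_mul_exp_neg_norm_rpow (hν : IsOneSidedStable (θ / 2) ν) (hθ : 0 < θ)
    (x : V) :
    ∫ ξ : V, Complex.exp (Complex.I * (inner ℝ x ξ : ℝ)) * (exp (-‖ξ‖ ^ θ) : ℝ) =
      (π ^ (finrank ℝ V / 2 : ℝ) * ∫ u, heatProfile (finrank ℝ V / 2) ‖x‖ u ∂ν : ℝ) := by
  have := hν.isProbabilityMeasure
  have hint : Integrable (fun p : ℝ × V => Complex.exp (Complex.I * (inner ℝ x p.2 : ℝ)) *
      (exp (-(‖p.2‖ ^ 2 * p.1)) : ℝ)) (ν.prod volume) := by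
    refine (hν.integrable_exp_neg_norm_sq_mul hθ).mono' (by fun_prop) (ae_of_all _ fun p => ?_)
    rw [norm_mul, mul_comm Complex.I, Complex.norm_exp_ofReal_mul_I, one_mul, Complex.norm_real,
      norm_of_nonneg (exp_pos _).le]
  calc _ = ∫ ξ : V, ∫ u : ℝ, Complex.exp (Complex.I * (inner ℝ x ξ : ℝ)) *
          (exp (-(‖ξ‖ ^ 2 * u)) : ℝ) ∂ν := by
        simp only [integral_const_mul, integral_complex_ofReal, hν.laplace_norm_sq]
    _ = ∫ u, (∫ ξ : V, Complex.exp (Complex.I * (inner ℝ x ξ : ℝ)) *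
          (exp (-(‖ξ‖ ^ 2 * u)) : ℝ)) ∂ν := (integral_integral_swap hint).symm
    _ = ∫ u, ((π ^ (finrank ℝ V / 2 : ℝ) * heatProfile (finrank ℝ V / 2) ‖x‖ u : ℝ) : ℂ) ∂ν := by
        refine integral_congr_ae ?_
        filter_upwards [hν.ae_pos] with u hu using integral_cexp_inner_mul_exp_neg_norm_sq_mul x hu
    _ = _ := by rw [integral_complex_ofReal, integral_const_mul]

end IsOneSidedStable

end FiniteDimensional

section FractionalHeatKernel

variable {N : ℕ} {θ : ℝ}

theorem IsOneSidedStable.fracHeatKernel_one_eq {ν : Measure ℝ} (hν : IsOneSidedStable (θ / 2) ν)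
    (hθ : 0 < θ) (x : EuclideanSpace ℝ (Fin N)) :
    fracHeatKernel θ x 1 =
      ((2 * π) ^ N)⁻¹ * π ^ (N / 2 : ℝ) * ∫ u, heatProfile (N / 2) ‖x‖ u ∂ν := by
  have hfourier := hν.integral_cexp_inner_mul_exp_neg_norm_rpow hθ x
  rw [finrank_euclideanSpace_fin] at hfourier
  simp only [fracHeatKernel, fracHeatKernelC, neg_one_mul, hfourier, Complex.re_ofReal_mul,
    Complex.ofReal_re, mul_assoc]

theorem exists_fracHeatKernel_one_bounds (N : ℕ) (hθ0 : 0 < θ) (hθ2 : θ < 2) :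
    ∃ c C : ℝ, 0 < c ∧ 0 < C ∧ ∀ x : EuclideanSpace ℝ (Fin N),
      c * (1 + ‖x‖) ^ (-(N + θ)) ≤ fracHeatKernel θ x 1 ∧
      fracHeatKernel θ x 1 ≤ C * (1 + ‖x‖) ^ (-(N + θ)) := by
  obtain ⟨ν, hν⟩ := exists_isOneSidedStable (α := θ / 2) (by linarith) (by linarith)
  have hint : Integrable (fun u => u ^ (-(N / 2 : ℝ))) ν := by
    simpa using hν.integrable_rpow_neg_finrank_div_two (EuclideanSpace ℝ (Fin N)) hθ0
  obtain ⟨c, C, hc, hC, hbounds⟩ := hν.exists_integral_heatProfile_bounds (s := N / 2)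
    (by positivity) (by linarith) (by linarith) hint
  rw [show 2 * (N / 2 : ℝ) + 2 * (θ / 2) = N + θ by ring] at hbounds
  have hk : 0 < ((2 * π) ^ N)⁻¹ * π ^ (N / 2 : ℝ) := by positivity
  refine ⟨_, _, mul_pos hk hc, mul_pos hk hC, fun x => ?_⟩
  rw [hν.fracHeatKernel_one_eq hθ0, mul_assoc _ c, mul_assoc _ C]
  obtain ⟨hlower, hupper⟩ := hbounds ‖x‖ (norm_nonneg x)
  exact ⟨mul_le_mul_of_nonneg_left hlower hk.le, mul_le_mul_of_nonneg_left hupper hk.le⟩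

theorem measurable_fracHeatKernel (θ t : ℝ) :
    Measurable fun x : EuclideanSpace ℝ (Fin N) => fracHeatKernel θ x t := by
  have hfourier : StronglyMeasurable fun x : EuclideanSpace ℝ (Fin N) =>
      ∫ ξ : EuclideanSpace ℝ (Fin N),
        Complex.exp (Complex.I * (inner ℝ x ξ : ℝ)) * (exp (-t * ‖ξ‖ ^ θ) : ℝ) := by
    refine StronglyMeasurable.integral_prod_right (Measurable.stronglyMeasurable ?_)
    unfold Function.uncurry
    fun_prop
  exact Complex.measurable_re.comp (hfourier.measurable.const_mul _)

theorem fracHeatKernel_scaling (θ : ℝ) (x : EuclideanSpace ℝ (Fin N)) {ρ : ℝ} (hρ : 0 < ρ) :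
    fracHeatKernel θ x (ρ ^ θ) = (ρ ^ N)⁻¹ * fracHeatKernel θ (ρ⁻¹ • x) 1 := by
  have hsubst := Measure.integral_comp_smul (volume : Measure (EuclideanSpace ℝ (Fin N)))
    (fun ξ => Complex.exp (Complex.I * (inner ℝ (ρ⁻¹ • x) ξ : ℝ)) *
      (exp (-1 * ‖ξ‖ ^ θ) : ℝ)) ρ
  simp only [real_inner_smul_left, real_inner_smul_right, mul_inv_cancel_left₀ hρ.ne', norm_smul,
    norm_of_nonneg hρ.le, mul_rpow hρ.le (norm_nonneg _), neg_one_mul, ← neg_mul,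
    finrank_euclideanSpace_fin, abs_of_pos (inv_pos.2 (pow_pos hρ N))] at hsubst
  simp only [fracHeatKernel, fracHeatKernelC, hsubst, real_inner_smul_left, neg_one_mul,
    Complex.real_smul, Complex.re_ofReal_mul]
  exact mul_left_comm ..

end FractionalHeatKernel

/-- The profile `ρ^θ (ρ + r)^{-N-θ}`, comparable to `P_θ(x, ρ^θ)` in `ℝᴺ` at `|x| = r`. -/
noncomputable def stableProfile (N : ℕ) (θ ρ r : ℝ) : ℝ := ρ ^ θ * (ρ + r) ^ (-(N + θ))

section StableProfile

variable {N : ℕ} {θ : ℝ}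

theorem stableProfile_pos (N : ℕ) (θ : ℝ) {ρ r : ℝ} (hρ : 0 < ρ) (hr : 0 ≤ r) :
    0 < stableProfile N θ ρ r := by
  unfold stableProfile
  positivity

theorem stableProfile_le_of_add_le {a r A p q : ℝ} (hθ : 0 < θ) (ha : 0 < a) (har : a ≤ r)
    (hA : 0 < A) (hp : 0 ≤ p) (hq : 0 ≤ q) (h : r + p ≤ A * (a + q)) :
    stableProfile N θ a q ≤ A ^ (N + θ) * stableProfile N θ r p := by
  have hr : 0 < r := ha.trans_le har
  have hdecay : (a + q) ^ (-(N + θ)) ≤ A ^ (N + θ) * (r + p) ^ (-(N + θ)) := by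
    rw [← inv_mul_le_iff₀ (by positivity), ← rpow_neg hA.le, ← mul_rpow hA.le (by positivity)]
    exact rpow_le_rpow_of_nonpos (by positivity) h (neg_nonpos.2 (by positivity))
  calc a ^ θ * (a + q) ^ (-(N + θ)) ≤ r ^ θ * (A ^ (N + θ) * (r + p) ^ (-(N + θ))) := by gcongr
    _ = A ^ (N + θ) * (r ^ θ * (r + p) ^ (-(N + θ))) := mul_left_comm ..

theorem add_norm_le_or_add_norm_le {V : Type*} [SeminormedAddCommGroup V] {a b r κ : ℝ}
    (ha : 0 ≤ a) (hb : 0 ≤ b) (hκ : 0 ≤ κ) (hr : r ≤ κ * a ∨ r ≤ κ * b) (x y : V) :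
    r + ‖x‖ ≤ (4 + 2 * κ) * (a + ‖x - y‖) ∨ r + ‖x‖ ≤ (4 + 2 * κ) * (b + ‖y‖) := by
  have htri : ‖x‖ ≤ ‖x - y‖ + ‖y‖ := by simpa using norm_add_le (x - y) y
  have hκx : 0 ≤ κ * ‖x - y‖ := by positivity
  have hκy : 0 ≤ κ * ‖y‖ := by positivity
  have hκa : 0 ≤ κ * a := by positivity
  have hκb : 0 ≤ κ * b := by positivity
  rcases le_total ‖x‖ r with hxr | hrx
  · exact hr.imp (fun _ => by linarith [norm_nonneg (x - y)])
      (fun _ => by linarith [norm_nonneg y])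
  · exact (le_total ‖y‖ ‖x - y‖).imp (fun _ => by linarith [norm_nonneg (x - y)])
      (fun _ => by linarith [norm_nonneg y])

theorem stableProfile_mul_le {V : Type*} [SeminormedAddCommGroup V] {a b r κ : ℝ} (hθ : 0 < θ)
    (ha : 0 < a) (hb : 0 < b) (har : a ≤ r) (hbr : b ≤ r) (hκ : 0 ≤ κ)
    (hr : r ≤ κ * a ∨ r ≤ κ * b) (x y : V) :
    stableProfile N θ a ‖x - y‖ * stableProfile N θ b ‖y‖ ≤
      (4 + 2 * κ) ^ (N + θ) * stableProfile N θ r ‖x‖ *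
        (stableProfile N θ a ‖x - y‖ + stableProfile N θ b ‖y‖) := by
  have hφa := stableProfile_pos N θ ha (norm_nonneg (x - y))
  have hφb := stableProfile_pos N θ hb (norm_nonneg y)
  have hφr := stableProfile_pos N θ (ha.trans_le har) (norm_nonneg x)
  rw [mul_add]
  rcases add_norm_le_or_add_norm_le ha.le hb.le hκ hr x y with h | h
  · refine le_add_of_nonneg_of_le (by positivity) (mul_le_mul_of_nonneg_right ?_ hφb.le)
    exact stableProfile_le_of_add_le hθ ha har (by positivity) (norm_nonneg _) (norm_nonneg _) h
  · refine le_add_of_le_of_nonneg ?_ (by positivity)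
    rw [mul_comm (stableProfile N θ a _)]
    refine mul_le_mul_of_nonneg_right ?_ hφa.le
    exact stableProfile_le_of_add_le hθ hb hbr (by positivity) (norm_nonneg _) (norm_nonneg _) h

theorem stableProfile_eq_scaling {V : Type*} [SeminormedAddCommGroup V] [NormedSpace ℝ V] (θ : ℝ)
    (x : V) {ρ : ℝ} (hρ : 0 < ρ) :
    stableProfile N θ ρ ‖x‖ = (ρ ^ N)⁻¹ * (1 + ‖ρ⁻¹ • x‖) ^ (-(N + θ)) := by
  have hfactor : ρ + ‖x‖ = ρ * (1 + ‖ρ⁻¹ • x‖) := by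
    rw [norm_smul, norm_inv, norm_of_nonneg hρ.le, mul_add, mul_inv_cancel_left₀ hρ.ne', mul_one]
  rw [stableProfile, hfactor, mul_rpow hρ.le (by positivity), ← mul_assoc, ← rpow_add hρ,
    show θ + -(N + θ) = -(N : ℝ) by ring, rpow_neg hρ.le, rpow_natCast]

open Module

variable {V : Type*} [NormedAddCommGroup V] [NormedSpace ℝ V] [FiniteDimensional ℝ V]
  [MeasurableSpace V] [BorelSpace V] (μ : Measure V) [μ.IsAddHaarMeasure]

theorem integrable_stableProfile (hθ : 0 < θ) {ρ : ℝ} (hρ : 0 < ρ) :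
    Integrable (fun x : V => stableProfile (finrank ℝ V) θ ρ ‖x‖) μ := by
  simp only [stableProfile_eq_scaling θ _ hρ]
  refine Integrable.const_mul ?_ _
  rw [integrable_comp_smul_iff μ (fun x : V => (1 + ‖x‖) ^ (-(finrank ℝ V + θ)))
    (inv_ne_zero hρ.ne')]
  exact integrable_one_add_norm (lt_add_of_pos_right _ hθ)

theorem integral_stableProfile (θ : ℝ) {ρ : ℝ} (hρ : 0 < ρ) :
    ∫ x : V, stableProfile (finrank ℝ V) θ ρ ‖x‖ ∂μ =
      ∫ x : V, stableProfile (finrank ℝ V) θ 1 ‖x‖ ∂μ := by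
  simp only [stableProfile_eq_scaling θ _ hρ, stableProfile_eq_scaling θ _ one_pos, one_pow,
    inv_one, one_smul, one_mul]
  rw [integral_const_mul, Measure.integral_comp_inv_smul μ
    (fun x : V => (1 + ‖x‖) ^ (-(finrank ℝ V + θ))), abs_of_pos (by positivity), smul_eq_mul,
    inv_mul_cancel_left₀ (by positivity)]

theorem integral_stableProfile_mul_le (hθ : 0 < θ) {a b r κ : ℝ} (ha : 0 < a) (hb : 0 < b)
    (har : a ≤ r) (hbr : b ≤ r) (hκ : 0 ≤ κ) (hr : r ≤ κ * a ∨ r ≤ κ * b) (x : V) :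
    Integrable (fun y => stableProfile (finrank ℝ V) θ a ‖x - y‖ *
      stableProfile (finrank ℝ V) θ b ‖y‖) μ ∧
    ∫ y, stableProfile (finrank ℝ V) θ a ‖x - y‖ * stableProfile (finrank ℝ V) θ b ‖y‖ ∂μ ≤
      (4 + 2 * κ) ^ (finrank ℝ V + θ) * (2 * ∫ y : V, stableProfile (finrank ℝ V) θ 1 ‖y‖ ∂μ) *
        stableProfile (finrank ℝ V) θ r ‖x‖ := by
  have hinta := (integrable_stableProfile μ hθ ha).comp_sub_left x
  have hintb := integrable_stableProfile μ hθ hb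
  have hdom := (hinta.add hintb).const_mul
    ((4 + 2 * κ) ^ (finrank ℝ V + θ) * stableProfile (finrank ℝ V) θ r ‖x‖)
  have hle := stableProfile_mul_le (N := finrank ℝ V) hθ ha hb har hbr hκ hr x
  have hint : Integrable (fun y => stableProfile (finrank ℝ V) θ a ‖x - y‖ *
      stableProfile (finrank ℝ V) θ b ‖y‖) μ := by
    refine hdom.mono' (hinta.1.mul hintb.1) (ae_of_all _ fun y => ?_)
    rw [norm_of_nonneg (mul_pos (stableProfile_pos _ θ ha (norm_nonneg _))
      (stableProfile_pos _ θ hb (norm_nonneg _))).le]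
    exact hle y
  refine ⟨hint, (integral_mono hint hdom hle).trans_eq ?_⟩
  simp only [Pi.add_apply]
  rw [integral_const_mul, integral_add hinta hintb,
    integral_sub_left_eq_self (fun y => stableProfile (finrank ℝ V) θ a ‖y‖),
    integral_stableProfile μ θ ha, integral_stableProfile μ θ hb]
  ring

end StableProfile

section MajorantKernel

variable {N : ℕ} {θ : ℝ}

theorem exists_majorantKernel_bounds (N : ℕ) (d : ℝ) (hθ0 : 0 < θ) (hθ2 : θ < 2) :
    ∃ c C : ℝ, 0 < c ∧ 0 < C ∧ ∀ (x : EuclideanSpace ℝ (Fin N)) (t : ℝ), 0 < t →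
      c * stableProfile N θ (t ^ (1 / d)) ‖x‖ ≤ majorantKernel d θ x t ∧
      majorantKernel d θ x t ≤ C * stableProfile N θ (t ^ (1 / d)) ‖x‖ := by
  obtain ⟨c, C, hc, hC, hbounds⟩ := exists_fracHeatKernel_one_bounds N hθ0 hθ2
  refine ⟨c, C, hc, hC, fun x t ht => ?_⟩
  have hρ : 0 < t ^ (1 / d) := by positivity
  have hscale : t ^ (θ / d) = (t ^ (1 / d)) ^ θ := by rw [← rpow_mul ht.le, one_div_mul_eq_div]
  obtain ⟨hlower, hupper⟩ := hbounds ((t ^ (1 / d))⁻¹ • x)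
  rw [majorantKernel, hscale, fracHeatKernel_scaling θ x hρ, stableProfile_eq_scaling θ x hρ,
    mul_left_comm c, mul_left_comm C]
  exact ⟨by gcongr, by gcongr⟩

theorem rpow_mul_one_add_le_stableProfile {V : Type*} [SeminormedAddCommGroup V] [NormedSpace ℝ V]
    {L k t : ℝ} (hθL : θ ≤ L) (hk : 0 ≤ k) (ht : 0 < t) (d : ℝ) (x : V) :
    t ^ (-((N + k) / d)) * (1 + t ^ (-(1 / d)) * ‖x‖) ^ (-(N : ℝ) - L - k) ≤
      t ^ (-(k / d)) * stableProfile N θ (t ^ (1 / d)) ‖x‖ := by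
  have hρ : 0 < t ^ (1 / d) := by positivity
  have hpower : t ^ (-((N + k) / d)) = t ^ (-(k / d)) * ((t ^ (1 / d)) ^ N)⁻¹ := by
    rw [← rpow_natCast, ← rpow_mul ht.le, ← rpow_neg ht.le, ← rpow_add ht]
    ring_nf
  have hnorm : t ^ (-(1 / d)) * ‖x‖ = ‖(t ^ (1 / d))⁻¹ • x‖ := by
    rw [norm_smul, norm_inv, norm_of_nonneg hρ.le, rpow_neg ht.le]
  rw [stableProfile_eq_scaling θ _ hρ, hpower, hnorm, mul_assoc]
  gcongr _ * (_ * ?_)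
  exact rpow_le_rpow_of_exponent_le (le_add_of_nonneg_right (norm_nonneg _)) (by linarith)

theorem rpow_le_two_rpow_mul_or {p s t : ℝ} (hp : 0 ≤ p) (hs : 0 ≤ s) (hst : s ≤ t) :
    t ^ p ≤ 2 ^ p * (t - s) ^ p ∨ t ^ p ≤ 2 ^ p * s ^ p := by
  rw [← mul_rpow zero_le_two (sub_nonneg.2 hst), ← mul_rpow zero_le_two hs]
  exact (le_total s (t - s)).imp
    (fun _ => rpow_le_rpow (hs.trans hst) (by linarith) hp)
    (fun _ => rpow_le_rpow (hs.trans hst) (by linarith) hp)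

theorem exists_stableProfile_convolution_le (N : ℕ) {d : ℝ} (hd : 0 < d) (hθ : 0 < θ) :
    ∃ M : ℝ, 0 < M ∧ ∀ (x : EuclideanSpace ℝ (Fin N)) (s t : ℝ), 0 < s → s < t →
      Integrable (fun y => stableProfile N θ ((t - s) ^ (1 / d)) ‖x - y‖ *
        stableProfile N θ (s ^ (1 / d)) ‖y‖) ∧
      ∫ y, stableProfile N θ ((t - s) ^ (1 / d)) ‖x - y‖ * stableProfile N θ (s ^ (1 / d)) ‖y‖
        ≤ M * stableProfile N θ (t ^ (1 / d)) ‖x‖ := by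
  have hmass : 0 < ∫ y : EuclideanSpace ℝ (Fin N), stableProfile N θ 1 ‖y‖ := by
    have hint := integrable_stableProfile (volume : Measure (EuclideanSpace ℝ (Fin N))) hθ one_pos
    have hpos (y : EuclideanSpace ℝ (Fin N)) := stableProfile_pos N θ one_pos (norm_nonneg y)
    rw [finrank_euclideanSpace_fin] at hint
    rw [integral_pos_iff_support_of_nonneg (fun y => (hpos y).le) hint,
      Function.support_eq_univ fun y => (hpos y).ne']
    exact Measure.measure_univ_pos.2 (NeZero.ne _)
  refine ⟨(4 + 2 * 2 ^ (1 / d)) ^ (N + θ) *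
    (2 * ∫ y : EuclideanSpace ℝ (Fin N), stableProfile N θ 1 ‖y‖), by positivity,
    fun x s t hs hst => ?_⟩
  have hts : 0 < t - s := sub_pos.2 hst
  have hd' : 0 ≤ 1 / d := by positivity
  have hconv := integral_stableProfile_mul_le (volume : Measure (EuclideanSpace ℝ (Fin N))) hθ
    (rpow_pos_of_pos hts (1 / d)) (rpow_pos_of_pos hs (1 / d))
    (rpow_le_rpow hts.le (sub_le_self t hs.le) hd') (rpow_le_rpow hs.le hst.le hd')
    (by positivity) (rpow_le_two_rpow_mul_or hd' hs.le hst.le) x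
  rwa [finrank_euclideanSpace_fin] at hconv

theorem exists_majorantKernel_convolution_le (N : ℕ) {d : ℝ} (hd : 0 < d) (hθ0 : 0 < θ)
    (hθ2 : θ < 2) :
    ∃ C : ℝ, 0 < C ∧ ∀ (x : EuclideanSpace ℝ (Fin N)) (s t : ℝ), 0 < s → s < t →
      Integrable (fun y => majorantKernel d θ (x - y) (t - s) * majorantKernel d θ y s) ∧
      ∫ y, majorantKernel d θ (x - y) (t - s) * majorantKernel d θ y s
        ≤ C * majorantKernel d θ x t := by
  obtain ⟨c, C, hc, hC, hK⟩ := exists_majorantKernel_bounds N d hθ0 hθ2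
  have hK0 (z : EuclideanSpace ℝ (Fin N)) {τ : ℝ} (hτ : 0 < τ) : 0 ≤ majorantKernel d θ z τ :=
    (mul_pos hc (stableProfile_pos N θ (by positivity) (norm_nonneg z))).le.trans (hK z τ hτ).1
  obtain ⟨M, hM, hprofile⟩ := exists_stableProfile_convolution_le N hd hθ0
  refine ⟨C ^ 2 * M / c, by positivity, fun x s t hs hst => ?_⟩
  have hts : 0 < t - s := sub_pos.2 hst
  obtain ⟨hprofile_int, hprofile_le⟩ := hprofile x s t hs hst
  have hle (y : EuclideanSpace ℝ (Fin N)) :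
      majorantKernel d θ (x - y) (t - s) * majorantKernel d θ y s ≤ C ^ 2 *
        (stableProfile N θ ((t - s) ^ (1 / d)) ‖x - y‖ * stableProfile N θ (s ^ (1 / d)) ‖y‖) :=
    (mul_le_mul (hK _ _ hts).2 (hK _ _ hs).2 (hK0 _ hs) ((hK0 _ hts).trans (hK _ _ hts).2)).trans_eq
      (by ring)
  have hint : Integrable fun y : EuclideanSpace ℝ (Fin N) =>
      majorantKernel d θ (x - y) (t - s) * majorantKernel d θ y s := by
    refine (hprofile_int.const_mul (C ^ 2)).mono' ?_ (ae_of_all _ fun y => ?_)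
    · exact (((measurable_fracHeatKernel θ _).comp (measurable_const.sub measurable_id)).mul
        (measurable_fracHeatKernel θ _)).aestronglyMeasurable
    · rw [norm_of_nonneg (mul_nonneg (hK0 _ hts) (hK0 _ hs))]
      exact hle y
  refine ⟨hint, ?_⟩
  calc _ ≤ C ^ 2 * (M * stableProfile N θ (t ^ (1 / d)) ‖x‖) := by
        refine (integral_mono hint (hprofile_int.const_mul _) hle).trans ?_
        rw [integral_const_mul]
        gcongr
    _ = C ^ 2 * M / c * (c * stableProfile N θ (t ^ (1 / d)) ‖x‖) := by field_simp
    _ ≤ _ := by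
        gcongr
        exact (hK x t (hs.trans hst)).1

end MajorantKernel

theorem theorem1p1_general {N n : ℕ} {d L θ : ℝ} {T : EReal} (hd : 0 < d) (hθ0 : 0 < θ)
    (hθ2 : θ < 2) (hθL : θ ≤ L)
    (D : ℕ → EuclideanSpace ℝ (Fin N) → EuclideanSpace ℝ (Fin N) → ℝ → ℝ)
    (hD : ∃ C : ℝ, 0 < C ∧ ∀ j : ℕ, j ≤ n →
      ∀ (x y : EuclideanSpace ℝ (Fin N)) (t : ℝ), 0 < t → (t : EReal) < T →
        D j x y t ≤
          C * t ^ (-((N + j : ℝ) / d)) * (1 + t ^ (-(1 / d)) * ‖x - y‖) ^ (-(N : ℝ) - L - j)) :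
    (∀ j : ℕ, j ≤ n → ∃ c : ℝ, 0 < c ∧
      ∀ (x y : EuclideanSpace ℝ (Fin N)) (t : ℝ), 0 < t → (t : EReal) < T →
        D j x y t ≤ c * t ^ (-((j : ℝ) / d)) * majorantKernel d θ (x - y) t) ∧
    (∃ C : ℝ, 0 < C ∧ ∀ (x : EuclideanSpace ℝ (Fin N)) (s t : ℝ), 0 < s → s < t →
      Integrable (fun y => majorantKernel d θ (x - y) (t - s) * majorantKernel d θ y s) ∧
      ∫ y, majorantKernel d θ (x - y) (t - s) * majorantKernel d θ y s
        ≤ C * majorantKernel d θ x t) := by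
  refine ⟨fun j hj => ?_, exists_majorantKernel_convolution_le N hd hθ0 hθ2⟩
  obtain ⟨c, _, hc, _, hK⟩ := exists_majorantKernel_bounds N d hθ0 hθ2
  obtain ⟨C, hC, hbound⟩ := hD
  refine ⟨C / c, by positivity, fun x y t ht htT => (hbound j hj x y t ht htT).trans ?_⟩
  calc _ ≤ C * (t ^ (-((j : ℝ) / d)) * stableProfile N θ (t ^ (1 / d)) ‖x - y‖) := by
        rw [mul_assoc]
        gcongr C * ?_
        exact rpow_mul_one_add_le_stableProfile hθL j.cast_nonneg ht d (x - y)
    _ = C / c * t ^ (-((j : ℝ) / d)) * (c * stableProfile N θ (t ^ (1 / d)) ‖x - y‖) := by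
        field_simp
    _ ≤ _ := by
        gcongr
        exact (hK _ t ht).1

theorem theorem1p1 {N : ℕ} (hN : 1 ≤ N) (ℓ m : ℕ) (d L : ℝ) (T : EReal)
    (G : EuclideanSpace ℝ (Fin N) → EuclideanSpace ℝ (Fin N) → ℝ → ℝ)
    (hG : ConditionG ℓ m d L T G)
    (θ : ℝ) (hθ0 : 0 < θ) (hθ2 : θ < 2) (hθ : θ ≤ min d L) :
    (∀ j : ℕ, j ≤ ℓ + m → ∃ c : ℝ, 0 < c ∧
      ∀ (x y : EuclideanSpace ℝ (Fin N)) (t : ℝ), 0 < t → (t : EReal) < T →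
        gradNorm j (fun z => G z y t) x ≤ c * t ^ (-((j : ℝ) / d)) * majorantKernel d θ (x - y) t) ∧
    (∃ C : ℝ, 0 < C ∧ ∀ (x : EuclideanSpace ℝ (Fin N)) (s t : ℝ), 0 < s → s < t →
      Integrable (fun y => majorantKernel d θ (x - y) (t - s) * majorantKernel d θ y s) ∧
      ∫ y, majorantKernel d θ (x - y) (t - s) * majorantKernel d θ y s
        ≤ C * majorantKernel d θ x t) :=
  theorem1p1_general (hθ0.trans_le (le_min_iff.1 hθ).1) hθ0 hθ2 (le_min_iff.1 hθ).2
    (fun j x y t => gradNorm j (fun z => G z y t) x) hG.bound
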